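/- Let $X_1, X_2, \dots$ be a sequence of independent real random variables on a probability space, each with mean $0$ and variance $1$, and let $\beta_1, \beta_2, \dots$ be a sequence of real numbers, not all zero. Suppose that (i) there is a number $B > 0$ such that $\mathbb{E}(X_j^4) < B$ for all $j \ge 1$; and (ii) $\displaystyle \frac{\max_{1 \le j \le p} \beta_j^2}{\sum_{j=1}^p \beta_j^2} \to 0$ as $p \to \infty$. Then, as $p \to \infty$, $$\frac{1}{\sqrt{\sum_{j=1}^p \beta_j^2}} \sum_{j=1}^p \beta_j X_j \Rightarrow \mathsf{N}(0,1),$$ where $\Rightarrow$ denotes convergence in distribution. (The quotients are considered for those $p$ with $\sum_{j=1}^p \beta_j^2 > 0$, that is, for all sufficiently large $p$.) -/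

import Mathlib

open MeasureTheory ProbabilityTheory Filter
open scoped Topology

/-!
The proof goes through characteristic functions and Lévy's convergence theorem. Write
`c j = β j / √(∑ i < p, β i ^ 2)`, so that `∑ j < p, c j ^ 2 = 1`. By independence the normalized
sum has characteristic function `∏ j < p, φ j (c j * t)`, where `φ j` is that of `X j`, and the
limiting one is `exp (-t ^ 2 / 2) = ∏ j < p, exp (-(c j * t) ^ 2 / 2)`. All factors have norm at
most one, so the products differ by at most the sum of the differences of the factors
(`norm_prod_sub_prod_le_sum`). Each factor on either side agrees with `1 - (c j * t) ^ 2 / 2` up to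
a multiple of `|c j * t| ^ 3 + (c j * t) ^ 4`, uniformly in `j` since the fourth moments are bounded
(`norm_charFun_sub_exp_le`). Finally `∑ j < p, |c j| ^ 3 ≤ max |c j|` and
`∑ j < p, c j ^ 4 ≤ max c j ^ 2`, and these maxima tend to zero by assumption.
-/

lemma norm_prod_sub_prod_le_sum {ι R : Type*} [NormedCommRing R] [NormOneClass R] (s : Finset ι)
    (a b : ι → R) (ha : ∀ i ∈ s, ‖a i‖ ≤ 1) (hb : ∀ i ∈ s, ‖b i‖ ≤ 1) :
    ‖∏ i ∈ s, a i - ∏ i ∈ s, b i‖ ≤ ∑ i ∈ s, ‖a i - b i‖ := by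
  classical
  induction s using Finset.induction with
  | empty => simp
  | insert i s hi ih =>
    have ih := ih (fun j hj ↦ ha j (Finset.mem_insert_of_mem hj))
      (fun j hj ↦ hb j (Finset.mem_insert_of_mem hj))
    have hbs : ‖∏ j ∈ s, b j‖ ≤ 1 := (Finset.norm_prod_le s b).trans <|
      Finset.prod_le_one (fun _ _ ↦ norm_nonneg _) fun j hj ↦ hb j (Finset.mem_insert_of_mem hj)
    rw [Finset.prod_insert hi, Finset.prod_insert hi, Finset.sum_insert hi]
    calc ‖a i * ∏ j ∈ s, a j - b i * ∏ j ∈ s, b j‖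
        = ‖(a i - b i) * ∏ j ∈ s, b j + a i * (∏ j ∈ s, a j - ∏ j ∈ s, b j)‖ := by
          congr 1; ring
      _ ≤ ‖a i - b i‖ * ‖∏ j ∈ s, b j‖ + ‖a i‖ * ‖∏ j ∈ s, a j - ∏ j ∈ s, b j‖ :=
          (norm_add_le _ _).trans (add_le_add (norm_mul_le _ _) (norm_mul_le _ _))
      _ ≤ ‖a i - b i‖ * 1 + 1 * ∑ j ∈ s, ‖a j - b j‖ := by
          gcongr
          exact ha i (Finset.mem_insert_self i s)
      _ = _ := by ring

lemma norm_exp_mul_I_sub_le (x : ℝ) :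
    ‖Complex.exp (x * Complex.I) - (1 + x * Complex.I - x ^ 2 / 2)‖ ≤ 4 * |x| ^ 3 := by
  have hnorm : ‖(x * Complex.I : ℂ)‖ = |x| := by simp
  rcases le_total |x| 1 with h | h
  · have key := Complex.exp_bound (x := x * Complex.I) (by rwa [hnorm]) (n := 3) (by norm_num)
    rw [hnorm] at key
    have hsum : ∑ m ∈ Finset.range 3, (x * Complex.I : ℂ) ^ m / (m.factorial : ℂ)
        = 1 + x * Complex.I - x ^ 2 / 2 := by
      simp [Finset.sum_range_succ, mul_pow, Nat.factorial]
      ring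
    rw [hsum] at key
    refine key.trans ?_
    have := pow_nonneg (abs_nonneg x) 3
    norm_num [Nat.factorial]
    linarith
  · have h2 : ‖(x : ℂ) ^ 2 / 2‖ = |x| ^ 2 / 2 := by simp
    calc ‖Complex.exp (x * Complex.I) - (1 + x * Complex.I - x ^ 2 / 2)‖
        ≤ 1 + (1 + |x| + |x| ^ 2 / 2) := by
          refine (norm_sub_le _ _).trans ?_
          rw [Complex.norm_exp_ofReal_mul_I]
          gcongr
          refine (norm_sub_le _ _).trans ?_
          rw [h2]
          gcongr
          refine (norm_add_le _ _).trans ?_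
          rw [hnorm, norm_one]
      _ ≤ 4 * |x| ^ 3 := by
          have h1 : |x| ≤ |x| ^ 3 := le_self_pow₀ h (by norm_num)
          have h2 : |x| ^ 2 ≤ |x| ^ 3 := pow_le_pow_right₀ h (by norm_num)
          linarith

lemma abs_exp_neg_sub_le {u : ℝ} (hu : 0 ≤ u) : |(1 - u) - Real.exp (-u)| ≤ u ^ 2 := by
  have hlow := Real.add_one_le_exp (-u)
  rw [abs_of_nonpos (by linarith)]
  rcases le_total u 1 with h | h
  · have := Real.norm_exp_sub_one_sub_id_le (x := -u) (by simpa [abs_of_nonneg hu] using h)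
    rw [Real.norm_eq_abs, Real.norm_eq_abs, sq_abs, neg_sq] at this
    linarith [(abs_le.1 this).2]
  · have := Real.exp_le_one_iff.2 (neg_nonpos.2 hu)
    nlinarith

/-- The characteristic function of a standardized random variable is close to the Gaussian one, with
an error that depends on the law only through a bound on the fourth moment. -/
lemma norm_charFun_sub_exp_le {Ω : Type*} [MeasurableSpace Ω] {P : Measure Ω}
    [IsProbabilityMeasure P] {X : Ω → ℝ} (hX : AEMeasurable X P) (hmean : ∫ ω, X ω ∂P = 0)
    (hvar : variance X P = 1) {B : ℝ} (hint : Integrable (fun ω ↦ X ω ^ 4) P)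
    (hB : ∫ ω, X ω ^ 4 ∂P ≤ B) (s : ℝ) :
    ‖charFun (P.map X) s - Complex.exp (-s ^ 2 / 2)‖ ≤ 4 * (1 + B) * |s| ^ 3 + s ^ 4 := by
  have hL2 : MemLp X 2 P :=
    memLp_two_of_variance_ne_zero hX.aestronglyMeasurable (by simp [hvar])
  have hi1 : Integrable X P := hL2.integrable (by norm_num)
  have hi2 : Integrable (fun ω ↦ X ω ^ 2) P := hL2.integrable_sq
  have hsq : ∫ ω, X ω ^ 2 ∂P = 1 := by
    rw [← hvar, variance_of_integral_eq_zero hX hmean]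
  have hexp : Integrable (fun ω ↦ Complex.exp ((s * X ω : ℝ) * Complex.I)) P := by
    refine Integrable.of_bound (C := 1) ?_ (ae_of_all _ fun ω ↦ ?_)
    · exact AEMeasurable.aestronglyMeasurable (by fun_prop)
    · rw [Complex.norm_exp_ofReal_mul_I]
  have hlin : Integrable (fun ω ↦ (1 : ℂ) + ((s * X ω : ℝ) : ℂ) * Complex.I) P :=
    (integrable_const _).add ((hi1.const_mul s).ofReal.mul_const _)
  have hquad : Integrable (fun ω ↦ ((s * X ω : ℝ) : ℂ) ^ 2 / 2) P := by
    have := ((hi2.const_mul (s ^ 2 / 2)).ofReal (𝕜 := ℂ))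
    refine this.congr (ae_of_all _ fun ω ↦ ?_)
    simp
    ring
  have htaylor : charFun (P.map X) s - (1 - s ^ 2 / 2) = ∫ ω, (Complex.exp ((s * X ω : ℝ) *
      Complex.I) - (1 + ((s * X ω : ℝ) : ℂ) * Complex.I - ((s * X ω : ℝ) : ℂ) ^ 2 / 2)) ∂P := by
    have hlq : Integrable (fun ω ↦ (1 : ℂ) + ((s * X ω : ℝ) : ℂ) * Complex.I
        - ((s * X ω : ℝ) : ℂ) ^ 2 / 2) P := hlin.sub hquad
    rw [integral_sub hexp hlq, integral_sub hlin hquad,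
      integral_add (integrable_const _) ((hi1.const_mul s).ofReal.mul_const _),
      integral_mul_const, integral_div]
    simp_rw [← Complex.ofReal_pow, mul_pow]
    rw [integral_complex_ofReal, integral_complex_ofReal, integral_const_mul, integral_const_mul,
      hmean, hsq, charFun_apply_real, integral_map hX (by fun_prop)]
    simp
  have h1 : ‖charFun (P.map X) s - (1 - s ^ 2 / 2)‖ ≤ 4 * (1 + B) * |s| ^ 3 := by
    rw [htaylor]
    calc _ ≤ ∫ ω, 4 * |s| ^ 3 * (1 + X ω ^ 4) ∂P := by
          refine norm_integral_le_of_norm_le (((integrable_const _).add hint).const_mul _)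
            (ae_of_all _ fun ω ↦ ?_)
          refine (norm_exp_mul_I_sub_le _).trans ?_
          rw [abs_mul, mul_pow, ← mul_assoc]
          gcongr
          -- The third absolute moment is controlled by `|x| ^ 3 ≤ 1 + x ^ 4`.
          rw [← Even.pow_abs (by decide : Even 4) (X ω)]
          rcases le_total |X ω| 1 with h | h
          · have h3 : |X ω| ^ 3 ≤ 1 := pow_le_one₀ (abs_nonneg _) h
            have h4 : 0 ≤ |X ω| ^ 4 := by positivity
            linarith
          · have h4 : |X ω| ^ 3 ≤ |X ω| ^ 4 := pow_le_pow_right₀ h (by norm_num)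
            linarith
      _ = 4 * |s| ^ 3 * (1 + ∫ ω, X ω ^ 4 ∂P) := by
          rw [integral_const_mul, integral_add (integrable_const _) hint]
          simp
      _ ≤ 4 * |s| ^ 3 * (1 + B) := by gcongr
      _ = _ := by ring
  have h2 : ‖(1 - s ^ 2 / 2 : ℂ) - Complex.exp (-s ^ 2 / 2)‖ ≤ s ^ 4 := by
    have := abs_exp_neg_sub_le (u := s ^ 2 / 2) (by positivity)
    have heq : (1 - s ^ 2 / 2 : ℂ) - Complex.exp (-s ^ 2 / 2)
        = (((1 - s ^ 2 / 2) - Real.exp (-(s ^ 2 / 2)) : ℝ) : ℂ) := by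
      push_cast
      rw [neg_div]
    rw [heq, Complex.norm_real, Real.norm_eq_abs]
    have : 0 ≤ s ^ 4 := by positivity
    linarith
  exact (norm_sub_le_norm_sub_add_norm_sub _ _ _).trans (add_le_add h1 h2)

/-- If the weights satisfy `∑ c j ^ 2 = 1` and `c j ^ 2 ≤ m`, the characteristic function of
`∑ c j * X j` is close to that of the standard Gaussian when `m` is small. -/
lemma norm_charFun_sum_sub_exp_le {Ω ι : Type*} [MeasurableSpace Ω] {P : Measure Ω}
    [IsProbabilityMeasure P] {X : ι → Ω → ℝ} (hX : ∀ j, AEMeasurable (X j) P)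
    (hindep : iIndepFun X P) (hmean : ∀ j, ∫ ω, X j ω ∂P = 0)
    (hvar : ∀ j, variance (X j) P = 1) {B : ℝ} (hB0 : 0 ≤ B)
    (hint : ∀ j, Integrable (fun ω ↦ X j ω ^ 4) P) (hB : ∀ j, ∫ ω, X j ω ^ 4 ∂P ≤ B)
    (s : Finset ι) (c : ι → ℝ) {m : ℝ} (hc : ∑ j ∈ s, c j ^ 2 = 1) (hm : ∀ j ∈ s, c j ^ 2 ≤ m)
    (t : ℝ) :
    ‖charFun (P.map (fun ω ↦ ∑ j ∈ s, c j * X j ω)) t - Complex.exp (-t ^ 2 / 2)‖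
      ≤ 4 * (1 + B) * |t| ^ 3 * √m + t ^ 4 * m := by
  have hchar : charFun (P.map (fun ω ↦ ∑ j ∈ s, c j * X j ω)) t
      = ∏ j ∈ s, charFun (P.map (X j)) (c j * t) := by
    have hind : iIndepFun (fun j ω ↦ c j * X j ω) P :=
      hindep.comp (fun j x ↦ c j * x) (by fun_prop)
    rw [(hind.restrict s).charFun_map_fun_finsetSum_eq_prod
      (fun j _ ↦ (hX j).const_mul _), Finset.prod_apply]
    exact Finset.prod_congr rfl fun j _ ↦ charFun_map_mul_comp (hX j) _ _
  have hexp : Complex.exp (-t ^ 2 / 2) = ∏ j ∈ s, Complex.exp (-((c j * t : ℝ) : ℂ) ^ 2 / 2) := by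
    rw [← Complex.exp_sum]
    congr 1
    calc (-t ^ 2 / 2 : ℂ) = ((∑ j ∈ s, c j ^ 2 : ℝ) : ℂ) * (-t ^ 2 / 2) := by simp [hc]
      _ = _ := by
        push_cast
        rw [Finset.sum_mul]
        exact Finset.sum_congr rfl fun j _ ↦ by ring
  rw [hchar, hexp]
  refine (norm_prod_sub_prod_le_sum _ _ _ (fun j _ ↦ ?_) fun j _ ↦ ?_).trans ?_
  · have := Measure.isProbabilityMeasure_map (hX j)
    exact norm_charFun_le_one _
  · rw [← Complex.ofReal_pow, ← Complex.ofReal_neg, ← Complex.ofReal_ofNat, ← Complex.ofReal_div,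
      Complex.norm_exp_ofReal, Real.exp_le_one_iff]
    have := sq_nonneg (c j * t)
    linarith
  calc ∑ j ∈ s, ‖charFun (P.map (X j)) (c j * t) - Complex.exp (-((c j * t : ℝ) : ℂ) ^ 2 / 2)‖
      ≤ ∑ j ∈ s, (4 * (1 + B) * |t| ^ 3 * √m + t ^ 4 * m) * c j ^ 2 := by
        refine Finset.sum_le_sum fun j hj ↦ (norm_charFun_sub_exp_le (hX j) (hmean j) (hvar j)
          (hint j) (hB j) _).trans ?_
        have habs : |c j| ≤ √m := Real.abs_le_sqrt (hm j hj)
        calc 4 * (1 + B) * |c j * t| ^ 3 + (c j * t) ^ 4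
            = (4 * (1 + B) * |t| ^ 3 * |c j| + t ^ 4 * c j ^ 2) * c j ^ 2 := by
              rw [abs_mul, ← sq_abs (c j), mul_pow, mul_pow,
                ← Even.pow_abs (by decide : Even 4) (c j)]
              ring
          _ ≤ _ := by
              gcongr
              exact hm j hj
    _ = _ := by rw [← Finset.mul_sum, hc, mul_one]

/-- Normal approximation of normalized linear combinations of independent random variables.
The sequences are indexed from `0`, so that `X 0, …, X (p - 1)` are the first `p` variables. -/
theorem theorem1 {Ω : Type*} [MeasurableSpace Ω] (P : Measure Ω) [IsProbabilityMeasure P]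
    (X : ℕ → Ω → ℝ) (hX : ∀ j, AEMeasurable (X j) P)
    (hindep : iIndepFun X P)
    (hmean : ∀ j, ∫ ω, X j ω ∂P = 0)
    (hvar : ∀ j, variance (X j) P = 1)
    (β : ℕ → ℝ) (hβ : ∃ j, β j ≠ 0)
    (hmoment : ∃ B : ℝ, 0 < B ∧
      ∀ j, Integrable (fun ω ↦ X j ω ^ 4) P ∧ ∫ ω, X j ω ^ 4 ∂P < B)
    (hmax : Tendsto
      (fun p : ℕ ↦ (⨆ j : Fin p, β j ^ 2) / ∑ j ∈ Finset.range p, β j ^ 2) atTop (𝓝 0)) :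
    TendstoInDistribution
      (fun (p : ℕ) (ω : Ω) ↦
        (∑ j ∈ Finset.range p, β j * X j ω) / √(∑ j ∈ Finset.range p, β j ^ 2))
      atTop id (fun _ ↦ P) (gaussianReal 0 1) := by
  refine ⟨fun p ↦ (Finset.aemeasurable_fun_sum _ fun j _ ↦ (hX j).const_mul (β j)).div_const _,
    aemeasurable_id, ?_⟩
  obtain ⟨B, hB0, hB⟩ := hmoment
  obtain ⟨k, hk⟩ := hβ
  refine ProbabilityMeasure.tendsto_iff_tendsto_charFun.2 fun t ↦ ?_
  have hlim : charFun ((gaussianReal 0 1).map id) t = Complex.exp (-t ^ 2 / 2) := by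
    rw [Measure.map_id, charFun_gaussianReal]
    congr 1
    simp
    ring
  simp only [ProbabilityMeasure.coe_mk]
  rw [hlim, tendsto_iff_norm_sub_tendsto_zero]
  set M : ℕ → ℝ := fun p ↦ (⨆ j : Fin p, β j ^ 2) / ∑ j ∈ Finset.range p, β j ^ 2
  have hbound : Tendsto (fun p ↦ 4 * (1 + B) * |t| ^ 3 * √(M p) + t ^ 4 * M p) atTop (𝓝 0) := by
    simpa using (hmax.sqrt.const_mul (4 * (1 + B) * |t| ^ 3)).add (hmax.const_mul (t ^ 4))
  refine squeeze_zero' (.of_forall fun _ ↦ norm_nonneg _) ?_ hbound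
  -- Beyond the index of a nonzero weight the normalizing sum is positive.
  filter_upwards [eventually_gt_atTop k] with p hp
  have hS : 0 < ∑ j ∈ Finset.range p, β j ^ 2 :=
    Finset.sum_pos' (fun _ _ ↦ sq_nonneg _) ⟨k, Finset.mem_range.2 hp, by positivity⟩
  have hsq (j : ℕ) : (β j / √(∑ i ∈ Finset.range p, β i ^ 2)) ^ 2
      = β j ^ 2 / ∑ i ∈ Finset.range p, β i ^ 2 := by
    rw [div_pow, Real.sq_sqrt hS.le]
  have hrw : (fun ω ↦ (∑ j ∈ Finset.range p, β j * X j ω) / √(∑ j ∈ Finset.range p, β j ^ 2))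
      = fun ω ↦ ∑ j ∈ Finset.range p, β j / √(∑ i ∈ Finset.range p, β i ^ 2) * X j ω := by
    ext ω
    rw [Finset.sum_div]
    exact Finset.sum_congr rfl fun j _ ↦ by ring
  rw [hrw]
  refine norm_charFun_sum_sub_exp_le hX hindep hmean hvar hB0.le (fun j ↦ (hB j).1)
    (fun j ↦ (hB j).2.le) _ _ ?_ (fun j hj ↦ ?_) t
  · simp_rw [hsq]
    rw [← Finset.sum_div, div_self hS.ne']
  · rw [hsq]
    refine div_le_div_of_nonneg_right ?_ hS.le
    exact le_ciSup (f := fun i : Fin p ↦ β i ^ 2) (Set.finite_range _).bddAbove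
      ⟨j, Finset.mem_range.1 hj⟩
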